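/- For a real number $\beta>1$ let $T_\beta(x)=\beta x-\lfloor\beta x\rfloor$ on $[0,1)$ and, for $x\in[0,1)$, let $d_\beta(x)=a_1a_2\dots$ with $a_k=\lfloor\beta T_\beta^{k-1}(x)\rfloor$, an infinite word over $\mathcal A=\mathbb Z\cap[0,\beta)$. Let $d_\beta(1-0)=\lim_{\varepsilon\downarrow0}d_\beta(1-\varepsilon)$ (limit in the product topology). A finite word $w$ over $\mathcal A$ is admissible if every shift of the infinite word $w000\dots$ is lexicographically strictly smaller than $d_\beta(1-0)$. The beta shift $X_\beta$ is the set of bi-infinite words $(\xi_i)_{i\in\mathbb Z}$ over $\mathcal A$ such that $\xi_k\xi_{k+1}\dots\xi_m$ is admissible for all $k<m$. The number $\beta$ is called a Parry number if $X_\beta$ is sofic, i.e. is the set of label sequences of the bi-infinite walks on some finite directed graph with labelled edges. Theorem. For every integer $n\ge2$ the polynomial $x^n-x-1$ has exactly one real root $\beta_n>1$, and $\beta_n$ is a Parry number if and only if $n=2$ or $n=3$. Likewise, $d_{\beta_n}(1-0)$ is eventually periodic if and only if $n=2$ or $n=3$. -/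

import Mathlib

open Filter Topology

/-- The beta transformation `T_β(x) = βx - ⌊βx⌋` (a self-map of `[0,1)`). -/
noncomputable def betaTransformation (β x : ℝ) : ℝ := β * x - (⌊β * x⌋ : ℝ)

/-- The beta expansion `d_β(x) = a₁a₂…` of `x ∈ [0,1)`, where `a_k = ⌊β T_β^{k-1}(x)⌋`.
Infinite words are indexed from `0`, so the letter with index `k` is `a_{k+1}`. -/
noncomputable def betaExpansion (β x : ℝ) : ℕ → ℤ :=
  fun k => ⌊β * (betaTransformation β)^[k] x⌋

/-- The expansion of one, `d_β(1-0) = lim_{ε ↓ 0} d_β(1-ε)`, the limit being taken in the product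
topology on infinite words over the discrete space `ℤ`. For `β > 1` the limit exists, see
`tendsto_betaExpansion`. -/
noncomputable def expansionOfOne (β : ℝ) : ℕ → ℤ :=
  limUnder (𝓝[<] (1 : ℝ)) (betaExpansion β)

theorem eventually_floor_mul_eq {β : ℝ} (hβ : 1 < β) (y : ℝ) :
    ∀ᶠ x in 𝓝[<] y, ⌊β * x⌋ = ⌈β * y⌉ - 1 := by
  have hb : (0 : ℝ) < β := by linarith
  have hlt : ((⌈β * y⌉ : ℝ) - 1) / β < y := by
    rw [div_lt_iff₀ hb]
    have := Int.ceil_lt_add_one (β * y)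
    linarith [mul_comm β y]
  filter_upwards [Ioo_mem_nhdsLT hlt] with x hx
  rw [Int.floor_eq_iff]
  have h1 := (div_lt_iff₀ hb).1 hx.1
  have h2 := Int.le_ceil (β * y)
  have h3 : β * x < β * y := mul_lt_mul_of_pos_left hx.2 hb
  push_cast
  constructor <;> linarith [mul_comm β x]

theorem exists_tendsto_iterate_betaTransformation {β : ℝ} (hβ : 1 < β) (k : ℕ) :
    ∃ y : ℝ, Tendsto ((betaTransformation β)^[k]) (𝓝[<] (1 : ℝ)) (𝓝[<] y) := by
  induction k with
  | zero => exact ⟨1, tendsto_id⟩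
  | succ k ih =>
    obtain ⟨y, hy⟩ := ih
    have hb : (0 : ℝ) < β := by linarith
    refine ⟨β * y - ((⌈β * y⌉ - 1 : ℤ) : ℝ), ?_⟩
    · rw [Function.iterate_succ']
      refine Tendsto.comp ?_ hy
      rw [tendsto_nhdsWithin_iff]
      constructor
      · have hc : Tendsto (fun x => β * x - ((⌈β * y⌉ - 1 : ℤ) : ℝ)) (𝓝[<] y)
            (𝓝 (β * y - ((⌈β * y⌉ - 1 : ℤ) : ℝ))) :=
          (Continuous.tendsto (by fun_prop) y).mono_left nhdsWithin_le_nhds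
        refine hc.congr' ?_
        filter_upwards [eventually_floor_mul_eq hβ y] with x hx
        simp only [betaTransformation, hx]
      · filter_upwards [eventually_floor_mul_eq hβ y, self_mem_nhdsWithin] with x hx hxy
        have h3 : β * x < β * y := mul_lt_mul_of_pos_left hxy hb
        simp only [betaTransformation, hx, Set.mem_Iio]
        linarith

theorem tendsto_betaExpansion {β : ℝ} (hβ : 1 < β) :
    Tendsto (betaExpansion β) (𝓝[<] (1 : ℝ)) (𝓝 (expansionOfOne β)) := by
  choose y hy using exists_tendsto_iterate_betaTransformation hβ
  refine tendsto_nhds_limUnder ⟨fun k => ⌈β * y k⌉ - 1, ?_⟩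
  rw [tendsto_pi_nhds]
  intro k
  refine tendsto_nhds_of_eventually_eq ?_
  exact (hy k).eventually (eventually_floor_mul_eq hβ (y k))

/-- The Parry condition: every shift of the infinite word `w` is lexicographically strictly smaller
than `d_β(1-0)`. -/
def IsAdmissible (β : ℝ) (w : ℕ → ℤ) : Prop :=
  ∀ j : ℕ, toLex (fun k => w (k + j)) < toLex (expansionOfOne β)

/-- The infinite word `ξ_n ξ_{n+1} … ξ_m 0 0 0 …`. -/
def blockZeros (ξ : ℤ → ℤ) (n m : ℤ) : ℕ → ℤ :=
  fun k => if n + (k : ℤ) ≤ m then ξ (n + (k : ℤ)) else 0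

/-- The beta shift `X_β`: the bi-infinite words over the alphabet `ℤ ∩ [0, β)` all of whose finite
blocks `ξ_n … ξ_m`, `n < m`, are admissible (a finite word is admissible if, continued by zeros,
it satisfies the Parry condition). -/
def betaShift (β : ℝ) : Set (ℤ → ℤ) :=
  {ξ | (∀ i, 0 ≤ ξ i ∧ (ξ i : ℝ) < β) ∧ ∀ n m : ℤ, n < m → IsAdmissible β (blockZeros ξ n m)}

/-- A set of bi-infinite words is sofic if it is the set of label sequences of the bi-infinite walks
on some finite directed graph with labelled edges; `(u, a, v) ∈ E` is an edge from `u` to `v` with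
label `a`. -/
def IsSofic {A : Type*} (X : Set (ℤ → A)) : Prop :=
  ∃ (V : Type) (E : Set (V × A × V)), Finite V ∧ E.Finite ∧
    X = {ξ | ∃ v : ℤ → V, ∀ i : ℤ, (v i, ξ i, v (i + 1)) ∈ E}

/-- `β` is a Parry number if its beta shift is sofic (used for real `β > 1`). -/
def IsParryNumber (β : ℝ) : Prop := IsSofic (betaShift β)

/-- An infinite word is eventually periodic. -/
def IsEventuallyPeriodic {A : Type*} (c : ℕ → A) : Prop :=
  ∃ N p : ℕ, 0 < p ∧ ∀ k, N ≤ k → c (k + p) = c k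

/-! If the beta shift is sofic, two of the pasts `…000c₀…c_{k-1}`, with `c` the expansion of one,
reach the same set of graph vertices. They then allow the same futures, and since the expansion is
lexicographically extremal, two of its tails agree (`isEventuallyPeriodic_of_isParryNumber`).

An eventually periodic expansion gives an eventually periodic orbit of one. As `x^n - x - 1` is
irreducible over `ℚ`, the orbit formed with the same digits at any other root `ζ` is eventually
periodic too, hence bounded. If `|ζ| > 1` and the digits one are at least `m` apart, boundedness
forces `(|ζ|^m - 1)|ζ - 1| ≤ 1` (`conjugateOrbit_small_of_bounded`). For every `n ≥ 4` some root
violates this (`exists_conjugate_of_five_le`, `exists_conjugate_of_eq_four`).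

For `n = 2, 3` one has `β^q (β - 1) = 1` with `q = 1, 4`. The expansion is then `(10^q)^∞`, and the
shift consists of the binary words whose ones are separated by at least `q` zeros, which is sofic.
-/

/-! ### The orbit of one and its digits -/

/-- The orbit of `1` under the left-continuous version of the beta transformation. -/
noncomputable def quasiOrbit (β : ℝ) : ℕ → ℝ
  | 0 => 1
  | k + 1 => β * quasiOrbit β k - ((⌈β * quasiOrbit β k⌉ - 1 : ℤ) : ℝ)

theorem tendsto_iterate_betaTransformation {β : ℝ} (hβ : 1 < β) (k : ℕ) :
    Tendsto ((betaTransformation β)^[k]) (𝓝[<] (1 : ℝ)) (𝓝[<] (quasiOrbit β k)) := by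
  induction k with
  | zero => exact tendsto_id
  | succ k ih =>
    have hb : (0 : ℝ) < β := by linarith
    rw [Function.iterate_succ']
    refine Tendsto.comp ?_ ih
    set y := quasiOrbit β k with hy
    have hs : quasiOrbit β (k + 1) = β * y - ((⌈β * y⌉ - 1 : ℤ) : ℝ) := rfl
    rw [hs, tendsto_nhdsWithin_iff]
    constructor
    · have hc : Tendsto (fun x => β * x - ((⌈β * y⌉ - 1 : ℤ) : ℝ)) (𝓝[<] y)
          (𝓝 (β * y - ((⌈β * y⌉ - 1 : ℤ) : ℝ))) :=
        (Continuous.tendsto (by fun_prop) y).mono_left nhdsWithin_le_nhds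
      refine hc.congr' ?_
      filter_upwards [eventually_floor_mul_eq hβ y] with x hx
      simp only [betaTransformation, hx]
    · filter_upwards [eventually_floor_mul_eq hβ y, self_mem_nhdsWithin] with x hx hxy
      have h3 : β * x < β * y := mul_lt_mul_of_pos_left hxy hb
      simp only [betaTransformation, hx, Set.mem_Iio]
      linarith

theorem expansionOfOne_apply {β : ℝ} (hβ : 1 < β) (k : ℕ) :
    expansionOfOne β k = ⌈β * quasiOrbit β k⌉ - 1 := by
  have h1 : Tendsto (fun x => betaExpansion β x k) (𝓝[<] (1 : ℝ)) (𝓝 (expansionOfOne β k)) :=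
    (tendsto_pi_nhds.1 (tendsto_betaExpansion hβ)) k
  refine tendsto_nhds_unique h1 (tendsto_nhds_of_eventually_eq ?_)
  exact (tendsto_iterate_betaTransformation hβ k).eventually
    (eventually_floor_mul_eq hβ (quasiOrbit β k))

theorem quasiOrbit_succ {β : ℝ} (hβ : 1 < β) (k : ℕ) :
    quasiOrbit β (k + 1) = β * quasiOrbit β k - expansionOfOne β k := by
  rw [expansionOfOne_apply hβ]; rfl

theorem expansionOfOne_lt {β : ℝ} (hβ : 1 < β) (k : ℕ) :
    (expansionOfOne β k : ℝ) < β * quasiOrbit β k := by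
  rw [expansionOfOne_apply hβ]
  have := Int.ceil_lt_add_one (β * quasiOrbit β k)
  push_cast; linarith

theorem le_expansionOfOne_add_one {β : ℝ} (hβ : 1 < β) (k : ℕ) :
    β * quasiOrbit β k ≤ expansionOfOne β k + 1 := by
  rw [expansionOfOne_apply hβ]
  have := Int.le_ceil (β * quasiOrbit β k)
  push_cast; linarith

theorem quasiOrbit_pos {β : ℝ} (hβ : 1 < β) (k : ℕ) : 0 < quasiOrbit β k := by
  cases k with
  | zero => exact one_pos
  | succ k =>
    rw [quasiOrbit_succ hβ]
    linarith [expansionOfOne_lt hβ k]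

theorem quasiOrbit_le_one {β : ℝ} (hβ : 1 < β) (k : ℕ) : quasiOrbit β k ≤ 1 := by
  cases k with
  | zero => exact le_rfl
  | succ k =>
    rw [quasiOrbit_succ hβ]
    linarith [le_expansionOfOne_add_one hβ k]

theorem expansionOfOne_nonneg {β : ℝ} (hβ : 1 < β) (k : ℕ) : 0 ≤ expansionOfOne β k := by
  rw [expansionOfOne_apply hβ]
  have h : 0 < ⌈β * quasiOrbit β k⌉ :=
    Int.ceil_pos.2 (mul_pos (by linarith) (quasiOrbit_pos hβ k))
  omega

theorem expansionOfOne_lt_base {β : ℝ} (hβ : 1 < β) (k : ℕ) : (expansionOfOne β k : ℝ) < β := by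
  have h := expansionOfOne_lt hβ k
  have h1 := quasiOrbit_le_one hβ k
  nlinarith

theorem expansionOfOne_zero_pos {β : ℝ} (hβ : 1 < β) : 0 < expansionOfOne β 0 := by
  have h := le_expansionOfOne_add_one hβ 0
  have h1 : quasiOrbit β 0 = 1 := rfl
  rw [h1] at h
  have : (0 : ℝ) < expansionOfOne β 0 := by linarith
  exact_mod_cast this

theorem quasiOrbit_add_le {β : ℝ} (hβ : 1 < β) (i t : ℕ) :
    quasiOrbit β (i + t) ≤ β ^ t * quasiOrbit β i := by
  induction t with
  | zero => simp
  | succ t ih =>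
    rw [← add_assoc, quasiOrbit_succ hβ, pow_succ']
    have h : (0 : ℝ) ≤ expansionOfOne β (i + t) := by exact_mod_cast expansionOfOne_nonneg hβ _
    nlinarith

/-- While the digits agree, both orbits follow the same affine maps of slope `β`, so their
difference is multiplied by `β` at each step. -/
theorem quasiOrbit_sub_quasiOrbit {β : ℝ} (hβ : 1 < β) (i j t : ℕ)
    (h : ∀ l < t, expansionOfOne β (i + l) = expansionOfOne β (j + l)) :
    quasiOrbit β (i + t) - quasiOrbit β (j + t) = β ^ t * (quasiOrbit β i - quasiOrbit β j) := by
  induction t with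
  | zero => simp
  | succ t ih =>
    have ih' := ih fun l hl => h l (by omega)
    rw [← add_assoc, ← add_assoc, quasiOrbit_succ hβ, quasiOrbit_succ hβ, h t (by omega), pow_succ']
    linear_combination β * ih'

/-- A tail of zeros would make the orbit grow geometrically, yet it stays in `(0, 1]`. -/
theorem exists_expansionOfOne_ne_zero {β : ℝ} (hβ : 1 < β) (N : ℕ) :
    ∃ k, N ≤ k ∧ expansionOfOne β k ≠ 0 := by
  by_contra! hcon
  have hy : ∀ t, quasiOrbit β (N + t) = β ^ t * quasiOrbit β N := by
    intro t
    induction t with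
    | zero => simp
    | succ t ih =>
      rw [← add_assoc, quasiOrbit_succ hβ, hcon (N + t) (by omega), ih]
      push_cast; ring
  obtain ⟨t, ht⟩ := pow_unbounded_of_one_lt (1 / quasiOrbit β N) hβ
  have hp := quasiOrbit_pos hβ N
  rw [div_lt_iff₀ hp, ← hy] at ht
  linarith [quasiOrbit_le_one hβ (N + t)]

/-- Every shift of the expansion of one is lexicographically at most the expansion of one. -/
theorem expansionOfOne_shift_le {β : ℝ} (hβ : 1 < β) (j i : ℕ)
    (h : ∀ l < i, expansionOfOne β (j + l) = expansionOfOne β l) :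
    expansionOfOne β (j + i) ≤ expansionOfOne β i := by
  have h1 := quasiOrbit_sub_quasiOrbit hβ j 0 i (by simpa using h)
  have h2 : quasiOrbit β j ≤ quasiOrbit β 0 := quasiOrbit_le_one hβ j
  have h3 : quasiOrbit β (j + i) ≤ quasiOrbit β i := by
    rw [zero_add] at h1
    have : 0 < β ^ i := by positivity
    nlinarith
  rw [expansionOfOne_apply hβ, expansionOfOne_apply hβ]
  have : ⌈β * quasiOrbit β (j + i)⌉ ≤ ⌈β * quasiOrbit β i⌉ := Int.ceil_le_ceil (by gcongr)
  omega

/-- Two distinct points with the same digit sequence would separate by the factor `β^t` inside `(0,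
1]`. -/
theorem quasiOrbit_add_eq_of_periodic {β : ℝ} (hβ : 1 < β) {N p : ℕ}
    (h : ∀ k, N ≤ k → expansionOfOne β (k + p) = expansionOfOne β k) {k : ℕ} (hk : N ≤ k) :
    quasiOrbit β (k + p) = quasiOrbit β k := by
  by_contra hne
  have hd : 0 < |quasiOrbit β (k + p) - quasiOrbit β k| := abs_pos.2 (sub_ne_zero.2 hne)
  obtain ⟨t, ht⟩ := pow_unbounded_of_one_lt (1 / |quasiOrbit β (k + p) - quasiOrbit β k|) hβ
  rw [div_lt_iff₀ hd] at ht
  have h1 := quasiOrbit_sub_quasiOrbit hβ (k + p) k t fun l _ => by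
    rw [show k + p + l = k + l + p by ring]; exact h _ (by omega)
  have h2 : |quasiOrbit β (k + p + t) - quasiOrbit β (k + t)| ≤ 1 := by
    rw [abs_le]
    constructor <;> linarith [quasiOrbit_pos hβ (k + p + t), quasiOrbit_pos hβ (k + t),
      quasiOrbit_le_one hβ (k + p + t), quasiOrbit_le_one hβ (k + t)]
  rw [h1, abs_mul, abs_of_pos (by positivity : (0 : ℝ) < β ^ t)] at h2
  linarith

/-! ### Sofic shifts have an eventually periodic expansion of one -/

theorem isAdmissible_iff {β : ℝ} {w : ℕ → ℤ} :
    IsAdmissible β w ↔ ∀ j, ∃ i, (∀ l < i, w (l + j) = expansionOfOne β l) ∧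
      w (i + j) < expansionOfOne β i :=
  Iff.rfl

/-- The word `…000c₀…c_{k-1}` followed by the right-infinite word `t` from position `0` on. -/
def spliceWord (c : ℕ → ℤ) (k : ℕ) (t : ℕ → ℤ) : ℤ → ℤ :=
  fun i => if 0 ≤ i then t i.toNat else if 0 ≤ i + k then c (i + k).toNat else 0

theorem spliceWord_shift (c : ℕ → ℤ) (k : ℕ) (i : ℤ) :
    spliceWord c k (fun l => c (k + l)) i = if 0 ≤ i + k then c (i + k).toNat else 0 := by
  unfold spliceWord
  split_ifs with h1 h2 h2
  · dsimp only; congr 1; omega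
  · omega
  · rfl
  · rfl

/-- Strictness comes from the zero padding: the expansion of one has nonzero digits arbitrarily far
out, so the two words must differ somewhere. -/
theorem block_expansionOfOne_lt {β : ℝ} (hβ : 1 < β) (N M : ℤ) (w : ℕ → ℤ)
    (hw : ∀ k : ℕ, w k = if N + k ≤ M then
      (if 0 ≤ N + k then expansionOfOne β (N + k).toNat else 0) else 0) :
    ∃ i, (∀ l < i, w l = expansionOfOne β l) ∧ w i < expansionOfOne β i := by
  rcases lt_or_ge N 0 with hN | hN
  · refine ⟨0, by simp, ?_⟩
    have h0 : w 0 = 0 := by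
      rw [hw]; split_ifs with h1 h2
      · simp at h2; omega
      · rfl
      · rfl
    rw [h0]; exact expansionOfOne_zero_pos hβ
  · have hex : ∃ i, w i ≠ expansionOfOne β i := by
      obtain ⟨k, hk, hk0⟩ := exists_expansionOfOne_ne_zero hβ (M + 1).toNat
      refine ⟨k, ?_⟩
      rw [hw, if_neg (by omega)]
      exact hk0.symm
    classical
    have hmin : ∀ l < Nat.find hex, w l = expansionOfOne β l := fun l hl => by
      have := Nat.find_min hex hl
      simpa using this
    refine ⟨Nat.find hex, hmin, lt_of_le_of_ne ?_ (Nat.find_spec hex)⟩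
    set i := Nat.find hex
    by_cases hM : N + i ≤ M
    · rw [hw, if_pos hM, if_pos (by omega), show (N + (i : ℤ)).toNat = N.toNat + i by omega]
      refine expansionOfOne_shift_le hβ _ _ fun l hl => ?_
      rw [← hmin l hl, hw, if_pos (by omega), if_pos (by omega)]
      congr 1; omega
    · rw [hw, if_neg hM]
      exact expansionOfOne_nonneg hβ i

theorem spliceWord_mem_betaShift {β : ℝ} (hβ : 1 < β) (k : ℕ) :
    spliceWord (expansionOfOne β) k (fun l => expansionOfOne β (k + l)) ∈ betaShift β := by
  constructor
  · intro i
    rw [spliceWord_shift]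
    split_ifs
    · exact ⟨expansionOfOne_nonneg hβ _, expansionOfOne_lt_base hβ _⟩
    · exact ⟨le_rfl, by push_cast; linarith⟩
  · intro n m _
    rw [isAdmissible_iff]
    intro j
    refine block_expansionOfOne_lt hβ (n + j + k) (m + k) _ fun l => ?_
    unfold blockZeros
    rw [spliceWord_shift]
    push_cast
    rw [show n + ((l : ℤ) + j) + k = n + j + k + l by ring]
    by_cases h : n + ((l : ℤ) + j) ≤ m
    · rw [if_pos h, if_pos (by omega : n + j + k + (l : ℤ) ≤ m + k)]
    · rw [if_neg h, if_neg (by omega : ¬ n + j + k + (l : ℤ) ≤ m + k)]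

theorem le_of_spliceWord_mem_betaShift {β : ℝ} {k : ℕ} {t : ℕ → ℤ}
    (h : spliceWord (expansionOfOne β) k t ∈ betaShift β) (i : ℕ)
    (hi : ∀ l < i, t l = expansionOfOne β (k + l)) : t i ≤ expansionOfOne β (k + i) := by
  -- Ending the block at `i + 1` keeps its endpoints distinct even when `k = i = 0`.
  obtain ⟨q, hq, hlt⟩ := isAdmissible_iff.1 (h.2 (-k) (i + 1) (by omega)) 0
  have hw : ∀ l, l ≤ i → blockZeros (spliceWord (expansionOfOne β) k t) (-k) (i + 1) (k + l + 0)
      = t l := by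
    intro l hl
    unfold blockZeros spliceWord
    rw [if_pos (by omega), if_pos (by omega)]
    congr 1; omega
  have hw' : ∀ l, l < k → blockZeros (spliceWord (expansionOfOne β) k t) (-k) (i + 1) (l + 0)
      = expansionOfOne β l := by
    intro l hl
    unfold blockZeros spliceWord
    rw [if_pos (by omega), if_neg (by omega), if_pos (by omega)]
    congr 1; omega
  rcases lt_trichotomy q (k + i) with hqi | rfl | hqi
  · exfalso
    rcases lt_or_ge q k with hqk | hqk
    · rw [hw' q hqk] at hlt; exact lt_irrefl _ hlt
    · obtain ⟨l, rfl⟩ := Nat.exists_eq_add_of_le hqk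
      rw [hw l (by omega), hi l (by omega)] at hlt
      exact lt_irrefl _ hlt
  · rw [hw i le_rfl] at hlt; exact hlt.le
  · rw [← hw i le_rfl, hq _ hqi]

theorem isEventuallyPeriodic_of_isParryNumber {β : ℝ} (hβ : 1 < β) (h : IsParryNumber β) :
    IsEventuallyPeriodic (expansionOfOne β) := by
  obtain ⟨V, E, hV, -, hX⟩ := h
  set d := expansionOfOne β with hd
  -- The vertices reachable at time `0` by walks whose past reads `…000d₀…d_{k-1}`.
  let S : ℕ → Set V := fun k => {u | ∃ v : ℤ → V, v 0 = u ∧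
    ∀ i < 0, (v i, spliceWord d k (fun _ => 0) i, v (i + 1)) ∈ E}
  have hneg : ∀ k t t' (i : ℤ), i < 0 → spliceWord d k t i = spliceWord d k t' i := by
    intro k t t' i hi
    unfold spliceWord
    rw [if_neg (not_le.2 hi), if_neg (not_le.2 hi)]
  have hpos : ∀ k k' t (i : ℤ), 0 ≤ i → spliceWord d k t i = spliceWord d k' t i := by
    intro k k' t i hi
    unfold spliceWord
    rw [if_pos hi, if_pos hi]
  have hmem : ∀ j k, S j = S k → spliceWord d k (fun l => d (j + l)) ∈ betaShift β := by
    intro j k hjk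
    have h1 := spliceWord_mem_betaShift hβ j
    rw [hX] at h1 ⊢
    obtain ⟨v, hv⟩ := h1
    have h2 : v 0 ∈ S j := ⟨v, rfl, fun i hi => by
      rw [hneg j _ (fun l => d (j + l)) i hi]; exact hv i⟩
    rw [hjk] at h2
    obtain ⟨v', h0, hv'⟩ := h2
    -- Glue the past of one walk to the future of the other at their common vertex at time `0`.
    refine ⟨fun i => if i < 0 then v' i else v i, fun i => ?_⟩
    rcases lt_or_ge i 0 with hi | hi
    · have h3 := hv' i hi
      rw [hneg k _ (fun l => d (j + l)) i hi] at h3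
      simp only [if_pos hi]
      split_ifs with hi1
      · exact h3
      · have : i + 1 = 0 := by omega
        rw [this] at h3 ⊢
        rwa [h0] at h3
    · simp only [if_neg (not_lt.2 hi), if_neg (by omega : ¬ i + 1 < 0)]
      rw [hpos k j _ i hi]
      exact hv i
  obtain ⟨j, k, hne, hS⟩ := Finite.exists_ne_map_eq_of_infinite S
  have heq : ∀ i, d (j + i) = d (k + i) := by
    intro i
    induction i using Nat.strong_induction_on with
    | _ i ih =>
      exact le_antisymm (le_of_spliceWord_mem_betaShift (hmem j k hS) i ih)
        (le_of_spliceWord_mem_betaShift (hmem k j hS.symm) i fun l hl => (ih l hl).symm)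
  rcases lt_or_gt_of_ne hne with hjk | hjk
  · refine ⟨j, k - j, by omega, fun i hi => ?_⟩
    have := heq (i - j)
    rw [show j + (i - j) = i by omega, show k + (i - j) = i + (k - j) by omega] at this
    exact this.symm
  · refine ⟨k, j - k, by omega, fun i hi => ?_⟩
    have := heq (i - k)
    rwa [show j + (i - k) = i + (j - k) by omega, show k + (i - k) = i by omega] at this

/-! ### Purely periodic expansions and gap shifts -/

/-- The orbit runs through `1, β - 1, β(β - 1), …, β^q (β - 1) = 1` and closes up. Where `β` times
the orbit point equals `1`, the digit `⌈1⌉ - 1` is still `0`. -/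
theorem expansionOfOne_eq_ite_dvd {β : ℝ} (hβ : 1 < β) (hβ2 : β ≤ 2) {q : ℕ}
    (hq : β ^ q * (β - 1) = 1) (k : ℕ) :
    expansionOfOne β k = if (q + 1) ∣ k then 1 else 0 := by
  have digit : ∀ (i : ℕ) (c : ℤ), (c : ℝ) < β * quasiOrbit β i → β * quasiOrbit β i ≤ c + 1 →
      expansionOfOne β i = c := by
    intro i c h1 h2
    rw [expansionOfOne_apply hβ, sub_eq_iff_eq_add, Int.ceil_eq_iff]
    push_cast
    constructor <;> linarith
  have one : ∀ j, quasiOrbit β j = 1 → expansionOfOne β j = 1 := by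
    intro j hj
    apply digit <;> rw [hj] <;> push_cast <;> linarith
  have run : ∀ j, quasiOrbit β j = 1 → ∀ r ≤ q, quasiOrbit β (j + 1 + r) = β ^ r * (β - 1) ∧
      (r < q → expansionOfOne β (j + 1 + r) = 0) := by
    intro j hj r
    have zero : ∀ r < q, quasiOrbit β (j + 1 + r) = β ^ r * (β - 1) →
        expansionOfOne β (j + 1 + r) = 0 := by
      intro r hr h
      have h1 : β ^ (r + 1) ≤ β ^ q := pow_le_pow_right₀ hβ.le hr
      have h2 : 0 < β - 1 := by linarith
      apply digit
      · rw [Int.cast_zero]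
        exact mul_pos (by linarith) (quasiOrbit_pos hβ _)
      · rw [h, Int.cast_zero, zero_add, ← mul_assoc, ← pow_succ']
        calc β ^ (r + 1) * (β - 1) ≤ β ^ q * (β - 1) := by gcongr
          _ = 1 := hq
    induction r with
    | zero =>
      intro _
      have h : quasiOrbit β (j + 1 + 0) = β ^ 0 * (β - 1) := by
        rw [add_zero, quasiOrbit_succ hβ, hj, one j hj]; push_cast; ring
      exact ⟨h, fun h0 => zero 0 h0 h⟩
    | succ r ih =>
      intro hr
      obtain ⟨h1, h2⟩ := ih (by omega)
      have h : quasiOrbit β (j + 1 + (r + 1)) = β ^ (r + 1) * (β - 1) := by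
        rw [← add_assoc, quasiOrbit_succ hβ, h1, h2 (by omega)]; push_cast; ring
      exact ⟨h, fun h0 => zero _ h0 h⟩
  have per : ∀ a, quasiOrbit β ((q + 1) * a) = 1 := by
    intro a
    induction a with
    | zero => rfl
    | succ a ih =>
      rw [show (q + 1) * (a + 1) = (q + 1) * a + 1 + q by ring, (run _ ih q le_rfl).1, hq]
  split_ifs with h
  · obtain ⟨a, rfl⟩ := h
    exact one _ (per a)
  · have h1 := Nat.div_add_mod k (q + 1)
    have h2 : k % (q + 1) < q + 1 := Nat.mod_lt k (Nat.succ_pos q)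
    have h3 : k % (q + 1) ≠ 0 := fun h0 => h (Nat.dvd_of_mod_eq_zero h0)
    have h4 := (run _ (per (k / (q + 1))) (k % (q + 1) - 1) (by omega)).2 (by omega)
    rwa [show (q + 1) * (k / (q + 1)) + 1 + (k % (q + 1) - 1) = k by omega] at h4

theorem isEventuallyPeriodic_of_ite_dvd {c : ℕ → ℤ} {q : ℕ}
    (h : ∀ k, c k = if (q + 1) ∣ k then 1 else 0) : IsEventuallyPeriodic c :=
  ⟨0, q + 1, q.succ_pos, fun k _ => by simp only [h, Nat.dvd_add_self_right]⟩

theorem mem_betaShift_iff_of_ite_dvd {β : ℝ} (hβ : 1 < β) (hβ2 : β ≤ 2) {q : ℕ}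
    (hd : ∀ k, expansionOfOne β k = if (q + 1) ∣ k then 1 else 0) (ξ : ℤ → ℤ) :
    ξ ∈ betaShift β ↔ (∀ i, ξ i = 0 ∨ ξ i = 1) ∧
      ∀ (i : ℤ) (g : ℕ), 1 ≤ g → g ≤ q → ξ i = 1 → ξ (i + g) = 0 := by
  have hsmall : ∀ k, 1 ≤ k → k ≤ q → expansionOfOne β k = 0 := fun k h1 h2 => by
    rw [hd, if_neg fun h => by have := Nat.le_of_dvd h1 h; omega]
  have h0 : expansionOfOne β 0 = 1 := by rw [hd, if_pos (dvd_zero _)]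
  constructor
  · rintro ⟨hl, ha⟩
    have hl' : ∀ i, ξ i = 0 ∨ ξ i = 1 := fun i => by
      obtain ⟨h1, h2⟩ := hl i
      have : (ξ i : ℝ) < (2 : ℤ) := by push_cast; linarith
      have : ξ i < 2 := by exact_mod_cast this
      omega
    refine ⟨hl', fun i g hg1 hgq hi => ?_⟩
    refine (hl' _).resolve_right fun hg => ?_
    obtain ⟨k, hk, hlt⟩ := isAdmissible_iff.1 (ha i (i + g) (by omega)) 0
    have hw : ∀ l, l ≤ g → blockZeros ξ i (i + g) (l + 0) = ξ (i + l) := by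
      intro l hlg
      unfold blockZeros
      rw [if_pos (by omega), add_zero]
    rcases lt_or_ge g k with hgk | hgk
    · have := hk g hgk
      rw [hw g le_rfl, hg, hsmall g hg1 hgq] at this
      omega
    · rw [hw k hgk] at hlt
      rcases Nat.eq_zero_or_pos k with rfl | hk0
      · rw [h0] at hlt; simp [hi] at hlt
      · rw [hsmall k hk0 (by omega)] at hlt
        have := (hl (i + k)).1
        omega
  · rintro ⟨hl, hs⟩
    refine ⟨fun i => ?_, fun n m _ => isAdmissible_iff.2 fun j => ?_⟩
    · rcases hl i with h | h <;> rw [h] <;> constructor <;> norm_num <;> linarith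
    · set w : ℕ → ℤ := fun l => blockZeros ξ n m (l + j) with hw
      have hwval : ∀ l, w l = if n + ((l + j : ℕ) : ℤ) ≤ m then ξ (n + ((l + j : ℕ) : ℤ)) else 0 :=
        fun l => rfl
      have hw01 : ∀ l, w l = 0 ∨ w l = 1 := fun l => by
        rw [hwval]; split_ifs
        · exact hl _
        · exact Or.inl rfl
      have hex : ∃ i, w i ≠ expansionOfOne β i := by
        obtain ⟨k, hk, hk0⟩ := exists_expansionOfOne_ne_zero hβ (m + 1 - n).toNat
        refine ⟨k, ?_⟩
        rw [hwval, if_neg (by omega)]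
        exact hk0.symm
      classical
      have hmin : ∀ l < Nat.find hex, w l = expansionOfOne β l := fun l hl => by
        have := Nat.find_min hex hl
        simpa using this
      refine ⟨Nat.find hex, hmin, lt_of_le_of_ne ?_ (Nat.find_spec hex)⟩
      set i := Nat.find hex with hi
      change w i ≤ _
      rw [hd]
      split_ifs with hdvd
      · rcases hw01 i with h | h <;> omega
      · rcases hw01 i with h | h
        · exact h.le
        · exfalso
          have h1 := Nat.div_add_mod i (q + 1)
          have h2 : i % (q + 1) < q + 1 := Nat.mod_lt i (Nat.succ_pos q)
          have h3 : i % (q + 1) ≠ 0 := fun h0 => hdvd (Nat.dvd_of_mod_eq_zero h0)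
          -- The last multiple of `q + 1` before `i`: there the word still agrees with the
          -- expansion, so it has a one at distance at most `q` from the one at `i`.
          set a := (q + 1) * (i / (q + 1)) with ha
          have h4 := hmin a (by omega)
          rw [hd, if_pos ⟨_, ha⟩, hwval] at h4
          rw [hwval] at h
          split_ifs at h4 with h5
          swap
          · omega
          split_ifs at h with h6
          swap
          · omega
          have h7 := hs _ (i % (q + 1)) (by omega) (by omega) h4
          rw [show n + ((a + j : ℕ) : ℤ) + ((i % (q + 1) : ℕ) : ℤ) = n + ((i + j : ℕ) : ℤ) by
            omega] at h7
          omega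

/-- The set of bi-infinite binary words in which any two ones are separated by at least `q`
zeros is sofic. -/
theorem isSofic_gap (q : ℕ) : IsSofic {ξ : ℤ → ℤ | (∀ i, ξ i = 0 ∨ ξ i = 1) ∧
      ∀ (i : ℤ) (g : ℕ), 1 ≤ g → g ≤ q → ξ i = 1 → ξ (i + g) = 0} := by
  -- A vertex counts the zeros since the last one, capped at `q`; a one may be read only at `q` and
  -- resets the count.
  refine ⟨Fin (q + 1), {e | (e.2.1 = 0 ∧ (e.2.2 : ℕ) = min ((e.1 : ℕ) + 1) q) ∨
    (e.2.1 = 1 ∧ (e.1 : ℕ) = q ∧ (e.2.2 : ℕ) = 0)}, inferInstance, ?_, ?_⟩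
  · refine (Set.finite_univ.prod ((Set.toFinite ({0, 1} : Set ℤ)).prod Set.finite_univ)).subset ?_
    rintro ⟨u, a, v⟩ h
    rcases h with h | h
    · simpa using Or.inl h.1
    · simpa using Or.inr h.1
  · ext ξ
    constructor
    · rintro ⟨hl, hs⟩
      classical
      -- The disjunct `t = q` is the cap, and it covers pasts without a recent one.
      have hex : ∀ i : ℤ, ∃ t : ℕ, t = q ∨ ξ (i - 1 - t) = 1 := fun i => ⟨q, Or.inl rfl⟩
      have hle : ∀ i, Nat.find (hex i) ≤ q := fun i => Nat.find_min' _ (Or.inl rfl)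
      refine ⟨fun i => ⟨Nat.find (hex i), Nat.lt_succ_of_le (hle i)⟩, fun i => ?_⟩
      rcases hl i with hi | hi
      · refine Or.inl ⟨hi, ?_⟩
        change Nat.find (hex (i + 1)) = min (Nat.find (hex i) + 1) q
        rw [Nat.find_eq_iff]
        have hspec := Nat.find_spec (hex i)
        have hmin := fun t => @Nat.find_min _ _ (hex i) t
        have hq := hle i
        set T := Nat.find (hex i)
        constructor
        · rcases hspec with h | h
          · left; omega
          · rcases Nat.lt_or_ge T q with hT | hT
            · right
              rw [min_eq_left hT]
              rw [← h]; congr 1; push_cast; ring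
            · left; omega
        · intro t ht hc
          rcases hc with h | h
          · omega
          · rcases Nat.eq_zero_or_pos t with rfl | ht0
            · rw [show i + 1 - 1 - ((0 : ℕ) : ℤ) = i by simp, hi] at h; omega
            · refine hmin (t - 1) (by omega) (Or.inr ?_)
              rw [← h]; congr 1; omega
      · refine Or.inr ⟨hi, ?_, ?_⟩
        · change Nat.find (hex i) = q
          rw [Nat.find_eq_iff]
          refine ⟨Or.inl rfl, fun t ht hc => ?_⟩
          rcases hc with h | h
          · omega
          · have := hs _ (t + 1) (by omega) (by omega) h
            rw [show i - 1 - (t : ℤ) + ((t + 1 : ℕ) : ℤ) = i by push_cast; ring] at this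
            omega
        · change Nat.find (hex (i + 1)) = 0
          rw [Nat.find_eq_zero]
          right; simpa using hi
    · rintro ⟨v, hv⟩
      have hl : ∀ i, ξ i = 0 ∨ ξ i = 1 := fun i => (hv i).imp (fun h => h.1) (fun h => h.1)
      refine ⟨hl, fun i g hg1 hgq hi => ?_⟩
      have h0 : (v (i + 1) : ℕ) = 0 := by
        rcases hv i with h | h
        · have := h.1; simp only at this; omega
        · exact h.2.2
      have step : ∀ t : ℕ, t < q → (v (i + 1 + t) : ℕ) = t → ξ (i + 1 + t) = 0 ∧
          (v (i + 1 + (t + 1 : ℕ)) : ℕ) = t + 1 := by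
        intro t ht hvt
        rcases hv (i + 1 + t) with h | h
        · obtain ⟨h1, h2⟩ := h
          simp only at h1 h2
          refine ⟨h1, ?_⟩
          rw [show i + 1 + ((t + 1 : ℕ) : ℤ) = i + 1 + t + 1 by push_cast; ring, h2]
          omega
        · have := h.2.1; simp only at this; omega
      have all : ∀ t : ℕ, t < q → (v (i + 1 + t) : ℕ) = t := by
        intro t
        induction t with
        | zero => intro _; simpa using h0
        | succ t ih => intro ht; exact (step t (by omega) (ih (by omega))).2
      have := (step (g - 1) (by omega) (all _ (by omega))).1
      rw [← this]; congr 1; omega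

theorem isParryNumber_of_ite_dvd {β : ℝ} (hβ : 1 < β) (hβ2 : β ≤ 2) {q : ℕ}
    (hd : ∀ k, expansionOfOne β k = if (q + 1) ∣ k then 1 else 0) : IsParryNumber β := by
  have h := isSofic_gap q
  rwa [← show betaShift β = _ from Set.ext (mem_betaShift_iff_of_ite_dvd hβ hβ2 hd)] at h

/-! ### Conjugate orbits and the obstruction to periodicity -/

/-- The images of the orbit of one under the embedding sending the base to `ζ`. -/
noncomputable def conjugateOrbit (c : ℕ → ℤ) (ζ : ℂ) : ℕ → ℂ
  | 0 => 1
  | k + 1 => ζ * conjugateOrbit c ζ k - c k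

open Polynomial in
-- The digits are integers, so a single polynomial gives the orbit point at `β` and at every `ζ`.
theorem exists_orbit_polynomial {β : ℝ} (hβ : 1 < β) (k : ℕ) : ∃ P : ℚ[X],
    aeval β P = quasiOrbit β k ∧ ∀ ζ : ℂ, aeval ζ P = conjugateOrbit (expansionOfOne β) ζ k := by
  induction k with
  | zero => exact ⟨1, by simp [quasiOrbit], fun ζ => by simp [conjugateOrbit]⟩
  | succ k ih =>
    obtain ⟨P, h1, h2⟩ := ih
    refine ⟨X * P - C (expansionOfOne β k : ℚ), ?_, fun ζ => ?_⟩
    · rw [quasiOrbit_succ hβ]; simp [h1]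
    · rw [conjugateOrbit]; simp [h2]

open Polynomial in
/-- An algebraic coincidence in the orbit of one carries over to every conjugate. -/
theorem conjugateOrbit_eq_of_quasiOrbit_eq {β : ℝ} (hβ : 1 < β) {n : ℕ} (hn : 2 ≤ n)
    (h : β ^ n = β + 1) {ζ : ℂ} (hζ : ζ ^ n = ζ + 1) {i j : ℕ}
    (hij : quasiOrbit β i = quasiOrbit β j) :
    conjugateOrbit (expansionOfOne β) ζ i = conjugateOrbit (expansionOfOne β) ζ j := by
  obtain ⟨P, hP, hPζ⟩ := exists_orbit_polynomial hβ i
  obtain ⟨Q, hQ, hQζ⟩ := exists_orbit_polynomial hβ j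
  have hirr : Irreducible (X ^ n - X - 1 : ℚ[X]) :=
    X_pow_sub_X_sub_one_irreducible_rat (by omega)
  have hdvd1 : minpoly ℚ β ∣ (X ^ n - X - 1 : ℚ[X]) := minpoly.dvd ℚ β (by simp [h])
  have hint : IsIntegral ℚ β := by
    rw [← isAlgebraic_iff_isIntegral]
    exact ⟨_, hirr.ne_zero, by simp [h]⟩
  have hdvd2 : (X ^ n - X - 1 : ℚ[X]) ∣ minpoly ℚ β :=
    ((minpoly.irreducible hint).associated_of_dvd hirr hdvd1).symm.dvd
  have hdvd : (X ^ n - X - 1 : ℚ[X]) ∣ P - Q :=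
    hdvd2.trans (minpoly.dvd ℚ β (by simp [hP, hQ, hij]))
  obtain ⟨R, hR⟩ := hdvd
  have h0 : aeval ζ (P - Q) = 0 := by rw [hR]; simp [hζ]
  rw [map_sub, hPζ, hQζ] at h0
  exact sub_eq_zero.1 h0

theorem exists_norm_le_of_eventually_periodic {u : ℕ → ℂ} {N p : ℕ} (hp : 0 < p)
    (h : ∀ k, N ≤ k → u (k + p) = u k) : ∃ B, ∀ k, ‖u k‖ ≤ B := by
  have hex : ∀ k, ∃ l ∈ Finset.range (N + p), u k = u l := by
    intro k
    induction k using Nat.strong_induction_on with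
    | _ k ih =>
      by_cases hk : k < N + p
      · exact ⟨k, Finset.mem_range.2 hk, rfl⟩
      · obtain ⟨l, hl, hkl⟩ := ih (k - p) (by omega)
        refine ⟨l, hl, ?_⟩
        rw [← hkl, ← h (k - p) (by omega), Nat.sub_add_cancel (by omega)]
  refine ⟨∑ l ∈ Finset.range (N + p), ‖u l‖, fun k => ?_⟩
  obtain ⟨l, hl, hkl⟩ := hex k
  rw [hkl]
  exact Finset.single_le_sum (f := fun l => ‖u l‖) (fun _ _ => norm_nonneg _) hl

theorem conjugateOrbit_add_of_zero {c : ℕ → ℤ} {ζ : ℂ} {i t : ℕ}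
    (h : ∀ l < t, c (i + l) = 0) :
    conjugateOrbit c ζ (i + t) = ζ ^ t * conjugateOrbit c ζ i := by
  induction t with
  | zero => simp
  | succ t ih =>
    rw [← add_assoc, conjugateOrbit, h t (by omega), ih fun l hl => h l (by omega)]
    push_cast; ring

/-- A bounded conjugate orbit whose ones are at distance at least `m` is small after each one. -/
theorem conjugateOrbit_small_of_bounded {c : ℕ → ℤ} {ζ : ℂ} {m : ℕ} (hζ : 1 < ‖ζ‖)
    (h01 : ∀ k, c k = 0 ∨ c k = 1) (hinf : ∀ N, ∃ k, N ≤ k ∧ c k ≠ 0)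
    (hgap : ∀ i g, 1 ≤ g → c i = 1 → c (i + g) = 1 → m ≤ g)
    (hB : ∃ B, ∀ k, ‖conjugateOrbit c ζ k‖ ≤ B) {i : ℕ} (hi : c i = 1) :
    (‖ζ‖ ^ m - 1) * ‖conjugateOrbit c ζ (i + 1)‖ ≤ 1 := by
  obtain ⟨B, hB⟩ := hB
  set S : Set ℝ := {x | ∃ j, c j = 1 ∧ x = ‖conjugateOrbit c ζ (j + 1)‖} with hS
  have hbdd : BddAbove S := ⟨B, by rintro x ⟨j, -, rfl⟩; exact hB _⟩
  have hpos : 0 < ‖ζ‖ ^ m := by positivity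
  have hm1 : 1 ≤ ‖ζ‖ ^ m := one_le_pow₀ hζ.le
  -- From one digit one to the next, at distance `g + 1 ≥ m`, the value `u` becomes `ζ^(g+1) u - 1`.
  -- Bounding this by the supremum bounds `|u|`, and passing to the supremum gives `(|ζ|^m - 1) sup
  -- ≤ 1`.
  have key : ∀ x ∈ S, x ≤ (sSup S + 1) / ‖ζ‖ ^ m := by
    rintro x ⟨j, hj, rfl⟩
    have hex : ∃ g, c (j + 1 + g) ≠ 0 := by
      obtain ⟨k, hk, hk0⟩ := hinf (j + 1)
      exact ⟨k - (j + 1), by rwa [Nat.add_sub_cancel' hk]⟩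
    classical
    set g := Nat.find hex with hg
    have hone : c (j + 1 + g) = 1 := (h01 _).resolve_left (Nat.find_spec hex)
    have hzero : ∀ l < g, c (j + 1 + l) = 0 := fun l hl => by
      have := Nat.find_min hex hl
      simpa using this
    have hmg : m ≤ g + 1 := hgap j (g + 1) (by omega) hj (by rw [← hone]; congr 1; ring)
    have hrec : conjugateOrbit c ζ (j + 1 + g + 1) =
        ζ ^ (g + 1) * conjugateOrbit c ζ (j + 1) - 1 := by
      rw [conjugateOrbit, hone, conjugateOrbit_add_of_zero hzero]
      push_cast; ring
    have hle : ‖conjugateOrbit c ζ (j + 1 + g + 1)‖ ≤ sSup S := le_csSup hbdd ⟨_, hone, rfl⟩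
    rw [le_div_iff₀ hpos]
    calc ‖conjugateOrbit c ζ (j + 1)‖ * ‖ζ‖ ^ m
        ≤ ‖conjugateOrbit c ζ (j + 1)‖ * ‖ζ‖ ^ (g + 1) := by
          gcongr
          exact hζ.le
      _ = ‖conjugateOrbit c ζ (j + 1 + g + 1) + 1‖ := by
          rw [hrec, sub_add_cancel, norm_mul, norm_pow, mul_comm]
      _ ≤ ‖conjugateOrbit c ζ (j + 1 + g + 1)‖ + ‖(1 : ℂ)‖ := norm_add_le _ _
      _ ≤ sSup S + 1 := by rw [norm_one]; linarith
  have hmem : ‖conjugateOrbit c ζ (i + 1)‖ ∈ S := ⟨i, hi, rfl⟩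
  have hsup : sSup S ≤ (sSup S + 1) / ‖ζ‖ ^ m := csSup_le ⟨_, hmem⟩ key
  rw [le_div_iff₀ hpos] at hsup
  have hle := le_csSup hbdd hmem
  nlinarith

/-- Just after a digit one the orbit is at most `β - 1`; it grows by at most the factor `β` per
step, and another one needs `β` times the orbit point to exceed `1`. -/
theorem expansionOfOne_gap {β : ℝ} (hβ : 1 < β) {m : ℕ}
    (hm : ∀ g, 1 < β ^ g * (β - 1) → m ≤ g) {i g : ℕ} (hg : 1 ≤ g)
    (hi : expansionOfOne β i = 1) (hig : expansionOfOne β (i + g) = 1) : m ≤ g := by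
  refine hm g ?_
  have h1 := expansionOfOne_lt hβ (i + g)
  have h2 := quasiOrbit_add_le hβ (i + 1) (g - 1)
  rw [show i + 1 + (g - 1) = i + g by omega, quasiOrbit_succ hβ, hi] at h2
  rw [hig] at h1
  push_cast at h1 h2
  have h3 := quasiOrbit_le_one hβ i
  calc 1 < β * quasiOrbit β (i + g) := h1
    _ ≤ β * (β ^ (g - 1) * (β * quasiOrbit β i - 1)) := by gcongr
    _ = β ^ (g - 1 + 1) * (β * quasiOrbit β i - 1) := by ring
    _ = β ^ g * (β * quasiOrbit β i - 1) := by rw [Nat.sub_add_cancel hg]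
    _ ≤ β ^ g * (β - 1) := by
      gcongr
      nlinarith

/-- If the base has a conjugate `ζ` outside the unit disc that is far enough from `1` in terms of
the gap length `m`, the expansion of one is not eventually periodic. -/
theorem not_isEventuallyPeriodic_of_conjugate {β : ℝ} (hβ : 1 < β) (hβ2 : β ≤ 2) {n : ℕ}
    (hn : 2 ≤ n) (h : β ^ n = β + 1) {ζ : ℂ} (hζ : ζ ^ n = ζ + 1) (hζ1 : 1 < ‖ζ‖) {m : ℕ}
    (hm : ∀ g, 1 < β ^ g * (β - 1) → m ≤ g) (hlarge : 1 < (‖ζ‖ ^ m - 1) * ‖ζ - 1‖) :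
    ¬ IsEventuallyPeriodic (expansionOfOne β) := by
  rintro ⟨N, p, hp, hper⟩
  have h01 : ∀ k, expansionOfOne β k = 0 ∨ expansionOfOne β k = 1 := fun k => by
    have h1 := expansionOfOne_nonneg hβ k
    have h2 : (expansionOfOne β k : ℝ) < (2 : ℤ) := by
      push_cast; linarith [expansionOfOne_lt_base hβ k]
    have h3 : expansionOfOne β k < 2 := by exact_mod_cast h2
    omega
  have h0 : expansionOfOne β 0 = 1 :=
    (h01 0).resolve_left (expansionOfOne_zero_pos hβ).ne'
  have hB := exists_norm_le_of_eventually_periodic (u := conjugateOrbit (expansionOfOne β) ζ) hp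
    fun k hk => conjugateOrbit_eq_of_quasiOrbit_eq hβ hn h hζ
      (quasiOrbit_add_eq_of_periodic hβ hper hk)
  have hsmall := conjugateOrbit_small_of_bounded hζ1 h01 (exists_expansionOfOne_ne_zero hβ)
    (fun i g hg => expansionOfOne_gap hβ hm hg) hB h0
  have h1 : conjugateOrbit (expansionOfOne β) ζ (0 + 1) = ζ - 1 := by
    simp [conjugateOrbit, h0]
  rw [h1] at hsmall
  linarith

/-! ### Conjugates outside the unit disc -/

/-- For `z = ρ e^{iθ}`, the imaginary parts of `z^(N+1) = z + 1` and `z^N = 1 + 1/z` give `ρ =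
sin((N+1)θ) / (-sin(Nθ))`. Eliminating `ρ` leaves one equation in `θ`, solved by a sign change: one
of the two sines vanishes at each endpoint. -/
theorem exists_trinomial_root_arg {N k : ℕ} (hk : 1 ≤ k) (hkN : 2 * k < N) :
    ∃ θ ρ : ℝ, 2 * Real.pi * k / (N + 1) < θ ∧ θ < 2 * Real.pi * k / N ∧ 0 < ρ ∧
      ((ρ * Real.cos θ : ℝ) + (ρ * Real.sin θ : ℝ) * Complex.I) ^ (N + 1) =
        ((ρ * Real.cos θ : ℝ) + (ρ * Real.sin θ : ℝ) * Complex.I) + 1 := by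
  have hpi := Real.pi_pos
  have hN : (0 : ℝ) < N := by exact_mod_cast (by omega : 0 < N)
  have hk' : (1 : ℝ) ≤ k := by exact_mod_cast hk
  have hkN' : 2 * (k : ℝ) < N := by exact_mod_cast hkN
  set a := 2 * Real.pi * k / (N + 1) with ha
  set b := 2 * Real.pi * k / N with hb
  have haN : a * (N + 1) = k * (2 * Real.pi) := by rw [ha]; field_simp
  have hbN : b * N = k * (2 * Real.pi) := by rw [hb]; field_simp
  have ha0 : 0 < a := by positivity
  have hab : a < b := by rw [ha, hb]; gcongr; linarith
  have hbpi : b < Real.pi := by rw [hb, div_lt_iff₀ hN]; nlinarith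
  set g : ℝ → ℝ := fun θ => Real.sin (θ * (N + 1)) ^ (N + 1) -
    Real.sin θ * (-Real.sin (θ * N)) ^ N with hg
  have hgc : ContinuousOn g (Set.Icc a b) := by
    apply Continuous.continuousOn; rw [hg]; fun_prop
  have hga : g a < 0 := by
    have h1 : Real.sin (a * (N + 1)) = 0 := by
      rw [haN, ← zero_add ((k : ℝ) * (2 * Real.pi)), Real.sin_add_nat_mul_two_pi, Real.sin_zero]
    have h2 : Real.sin (a * N) = - Real.sin a := by
      rw [show a * N = k * (2 * Real.pi) - a by linarith, Real.sin_nat_mul_two_pi_sub]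
    have h3 : 0 < Real.sin a := Real.sin_pos_of_pos_of_lt_pi ha0 (by linarith)
    simp only [hg, h1, h2, neg_neg, zero_pow (Nat.succ_ne_zero N), zero_sub]
    have : 0 < Real.sin a * Real.sin a ^ N := by positivity
    linarith
  have hgb : 0 < g b := by
    have h1 : Real.sin (b * N) = 0 := by
      rw [hbN, ← zero_add ((k : ℝ) * (2 * Real.pi)), Real.sin_add_nat_mul_two_pi, Real.sin_zero]
    have h2 : Real.sin (b * (N + 1)) = Real.sin b := by
      rw [show b * (N + 1) = b + k * (2 * Real.pi) by linarith, Real.sin_add_nat_mul_two_pi]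
    have h3 : 0 < Real.sin b := Real.sin_pos_of_pos_of_lt_pi (by linarith) hbpi
    simp only [hg, h1, h2, neg_zero, zero_pow (by omega : N ≠ 0), mul_zero, sub_zero]
    positivity
  obtain ⟨θ, ⟨hθa, hθb⟩, hθ⟩ := intermediate_value_Ioo hab.le hgc ⟨hga, hgb⟩
  have hθN : (0 : ℝ) < N + 1 := by linarith
  have hs : 0 < Real.sin (θ * (N + 1)) := by
    rw [← Real.sin_sub_nat_mul_two_pi _ k]
    apply Real.sin_pos_of_pos_of_lt_pi
    · nlinarith
    · nlinarith
  have hS : 0 < -Real.sin (θ * N) := by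
    rw [← Real.sin_nat_mul_two_pi_sub _ k]
    apply Real.sin_pos_of_pos_of_lt_pi
    · nlinarith
    · nlinarith
  set s := Real.sin (θ * (N + 1)) with hsdef
  set S := -Real.sin (θ * N) with hSdef
  set ρ := s / S with hρ
  have hρ0 : 0 < ρ := div_pos hs hS
  refine ⟨θ, ρ, hθa, hθb, hρ0, ?_⟩
  have hθ' : s ^ (N + 1) = Real.sin θ * S ^ N := by
    have : s ^ (N + 1) - Real.sin θ * S ^ N = 0 := hθ
    linarith
  have hρS : ρ * S = s := div_mul_cancel₀ _ hS.ne'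
  have him : ρ ^ (N + 1) * s = ρ * Real.sin θ := by
    have h1 : S ^ (N + 1) ≠ 0 := (pow_pos hS _).ne'
    apply mul_right_cancel₀ h1
    calc ρ ^ (N + 1) * s * S ^ (N + 1) = (ρ * S) ^ (N + 1) * s := by
          rw [mul_pow]; ac_rfl
      _ = s ^ (N + 1) * s := by rw [hρS]
      _ = Real.sin θ * S ^ N * (ρ * S) := by rw [hθ', hρS]
      _ = ρ * Real.sin θ * S ^ (N + 1) := by ring
  have hSexp : S = -(s * Real.cos θ - Real.cos (θ * (N + 1)) * Real.sin θ) := by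
    rw [hSdef, hsdef, ← Real.sin_sub, show θ * (N + 1) - θ = θ * N by ring]
  have hre : ρ ^ (N + 1) * Real.cos (θ * (N + 1)) = 1 + ρ * Real.cos θ := by
    apply mul_left_cancel₀ hs.ne'
    linear_combination Real.cos (θ * (N + 1)) * him - ρ * hSexp + hρS
  have hz : ((ρ * Real.cos θ : ℝ) + (ρ * Real.sin θ : ℝ) * Complex.I) =
      (ρ : ℂ) * (Complex.cos θ + Complex.sin θ * Complex.I) := by
    push_cast; ring
  have hpow : ((ρ * Real.cos θ : ℝ) + (ρ * Real.sin θ : ℝ) * Complex.I) ^ (N + 1) =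
      ((ρ ^ (N + 1) * Real.cos (θ * (N + 1)) : ℝ) : ℂ) +
        ((ρ ^ (N + 1) * s : ℝ) : ℂ) * Complex.I := by
    rw [hz, mul_pow, Complex.cos_add_sin_mul_I_pow]
    rw [hsdef]
    push_cast
    rw [mul_comm ((N : ℂ) + 1) (θ : ℂ)]
    ring
  rw [hpow, hre, him]
  push_cast; ring

theorem norm_sq_polar (x y : ℝ) : ‖((x : ℝ) + (y : ℝ) * Complex.I : ℂ)‖ ^ 2 = x ^ 2 + y ^ 2 := by
  rw [Complex.sq_norm, Complex.normSq_add_mul_I]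

/-- Everything follows from `ρ^(2(N+1)) = |ζ + 1|² = ρ² + 2ρ cos θ + 1` with `cos θ ≥ 0`. -/
theorem norm_polar_bounds {N : ℕ} {θ ρ : ℝ} (hρ : 0 < ρ) (hcos : 0 ≤ Real.cos θ) {ζ : ℂ}
    (hζ : ζ = (ρ * Real.cos θ : ℝ) + (ρ * Real.sin θ : ℝ) * Complex.I)
    (h : ζ ^ (N + 1) = ζ + 1) :
    1 < ‖ζ‖ ∧ 2 ≤ ‖ζ‖ ^ (2 * (N + 1)) ∧ 2 - 2 * Real.cos θ ≤ ‖ζ - 1‖ ^ 2 := by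
  have hcs := Real.sin_sq_add_cos_sq θ
  have hn : ‖ζ‖ ^ 2 = ρ ^ 2 := by
    rw [hζ, norm_sq_polar]; linear_combination ρ ^ 2 * hcs
  have hnρ : ‖ζ‖ = ρ := by
    rwa [sq_eq_sq₀ (norm_nonneg _) hρ.le] at hn
  have h1 : ‖ζ + 1‖ ^ 2 = ρ ^ 2 + 2 * (ρ * Real.cos θ) + 1 := by
    rw [show ζ + 1 = ((ρ * Real.cos θ + 1 : ℝ) + (ρ * Real.sin θ : ℝ) * Complex.I : ℂ) by
      rw [hζ]; push_cast; ring, norm_sq_polar]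
    linear_combination ρ ^ 2 * hcs
  have h2 : ‖ζ - 1‖ ^ 2 = ρ ^ 2 - 2 * (ρ * Real.cos θ) + 1 := by
    rw [show ζ - 1 = ((ρ * Real.cos θ - 1 : ℝ) + (ρ * Real.sin θ : ℝ) * Complex.I : ℂ) by
      rw [hζ]; push_cast; ring, norm_sq_polar]
    linear_combination ρ ^ 2 * hcs
  have h3 : ρ ^ (2 * (N + 1)) = ρ ^ 2 + 2 * (ρ * Real.cos θ) + 1 := by
    rw [← h1, ← h, norm_pow, hnρ, ← pow_mul, mul_comm]
  have h4 : 0 ≤ ρ * Real.cos θ := by positivity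
  have hρ1 : 1 < ρ := by
    by_contra! hle
    have := pow_le_one₀ (n := 2 * (N + 1)) hρ.le hle
    nlinarith
  rw [hnρ, h3, h2]
  refine ⟨hρ1, by nlinarith, ?_⟩
  nlinarith [Real.cos_le_one θ]

theorem second_order_bernoulli {x : ℝ} (hx : 0 ≤ x) (n : ℕ) :
    1 + n * x + n * (n - 1) / 2 * x ^ 2 ≤ (1 + x) ^ n := by
  induction n with
  | zero => simp
  | succ n ih =>
    have h0 : (0 : ℝ) ≤ n * (n - 1) := by
      rcases Nat.eq_zero_or_pos n with rfl | hn
      · simp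
      · have : (1 : ℝ) ≤ n := by exact_mod_cast hn
        nlinarith
    have h1 : 0 ≤ n * (n - 1) / 2 * x ^ 3 := by positivity
    rw [pow_succ (1 + x)]
    push_cast
    nlinarith [mul_le_mul_of_nonneg_right ih (by linarith : 0 ≤ 1 + x)]

/-- With `y = N(β - 1)`, the second-order bound gives `y + y²/2 ≤ 1`, so `y ≤ √3 - 1 < 3/4`; the
first-order bound would only give `y ≤ 1`. -/
theorem trinomial_root_le {β : ℝ} (hβ : 1 < β) {N : ℕ} (hN : 1 ≤ N) (h : β ^ (N + 1) = β + 1) :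
    N * (β - 1) ≤ 3 / 4 := by
  have h1 := second_order_bernoulli (x := β - 1) (by linarith) (N + 1)
  rw [show 1 + (β - 1) = β by ring, h] at h1
  push_cast at h1
  have hN' : (1 : ℝ) ≤ N := by exact_mod_cast hN
  by_contra! hcon
  have hx : 0 < β - 1 := by linarith
  have h2 : (N * (β - 1)) ^ 2 ≤ (N + 1) * N * (β - 1) ^ 2 := by nlinarith [sq_nonneg (β - 1)]
  nlinarith

theorem exists_conjugate_of_five_le {β : ℝ} (hβ : 1 < β) {N : ℕ} (hN : 4 ≤ N)
    (h : β ^ (N + 1) = β + 1) : ∃ (ζ : ℂ) (m : ℕ), ζ ^ (N + 1) = ζ + 1 ∧ 1 < ‖ζ‖ ∧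
      (∀ g, 1 < β ^ g * (β - 1) → m ≤ g) ∧ 1 < (‖ζ‖ ^ m - 1) * ‖ζ - 1‖ := by
  have hpi := Real.pi_pos
  have hN4 : (4 : ℝ) ≤ N := by exact_mod_cast hN
  have hx := trinomial_root_le hβ (by omega) h
  have hx0 : 0 < β - 1 := by linarith
  -- The choice `k = N / 4` places `θ` in `[π/4, π/2]`: `cos θ` is nonnegative, but `ζ` stays away
  -- from `1`.
  obtain ⟨θ, ρ, hθa, hθb, hρ, hroot⟩ :=
    exists_trinomial_root_arg (N := N) (k := N / 4) (by omega) (by omega)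
  have hk4 : 4 * ((N / 4 : ℕ) : ℝ) ≤ N := by exact_mod_cast (by omega : 4 * (N / 4) ≤ N)
  have hk8 : (N + 1 : ℝ) ≤ 8 * ((N / 4 : ℕ) : ℝ) := by
    exact_mod_cast (by omega : N + 1 ≤ 8 * (N / 4))
  have hθ2 : θ ≤ Real.pi / 2 := by
    refine hθb.le.trans ?_
    rw [div_le_iff₀ (by linarith)]
    nlinarith
  have hθ4 : Real.pi / 4 ≤ θ := by
    refine le_trans ?_ hθa.le
    rw [le_div_iff₀ (by linarith)]
    nlinarith
  have hcos : 0 ≤ Real.cos θ := Real.cos_nonneg_of_mem_Icc ⟨by linarith, hθ2⟩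
  set ζ : ℂ := (ρ * Real.cos θ : ℝ) + (ρ * Real.sin θ : ℝ) * Complex.I with hζ
  obtain ⟨hζ1, hζ2, hζd⟩ := norm_polar_bounds hρ hcos hζ hroot
  have hex : ∃ g, 1 ≤ β ^ g * (β - 1) := by
    obtain ⟨g, hg⟩ := pow_unbounded_of_one_lt (1 / (β - 1)) hβ
    rw [div_lt_iff₀ hx0] at hg
    exact ⟨g, hg.le⟩
  classical
  refine ⟨ζ, Nat.find hex, hroot, hζ1, fun g hg => Nat.find_min' hex hg.le, ?_⟩
  have hm := Nat.find_spec hex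
  set m := Nat.find hex
  -- Compare `2(N+1)`-th powers, using `β + 1 ≤ 35/16` and `|ζ|^(2(N+1)) ≥ 2`. Since `β^m ≥ 4N/3`,
  -- this yields `|ζ|^m ≥ (4N/3)^(3/7)`.
  have hcmp : β ^ 3 ≤ ‖ζ‖ ^ 7 := by
    have h1 : (β ^ 3) ^ (2 * (N + 1)) ≤ (‖ζ‖ ^ 7) ^ (2 * (N + 1)) :=
      calc (β ^ 3) ^ (2 * (N + 1)) = (β ^ (N + 1)) ^ 6 := by ring
        _ = (β + 1) ^ 6 := by rw [h]
        _ ≤ (35 / 16) ^ 6 := by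
          gcongr
          nlinarith
        _ ≤ 2 ^ 7 := by norm_num
        _ ≤ (‖ζ‖ ^ (2 * (N + 1))) ^ 7 := by gcongr
        _ = (‖ζ‖ ^ 7) ^ (2 * (N + 1)) := by ring
    exact le_of_pow_le_pow_left₀ (by omega) (by positivity) h1
  have hA : (4 / 3 * N : ℝ) ^ 3 ≤ (‖ζ‖ ^ m) ^ 7 := by
    have h1 : (4 / 3 * N : ℝ) ≤ β ^ m := by
      have : (4 / 3 * N : ℝ) * (β - 1) ≤ β ^ m * (β - 1) := by linarith
      exact le_of_mul_le_mul_right this hx0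
    calc (4 / 3 * N : ℝ) ^ 3 ≤ (β ^ m) ^ 3 := by gcongr
      _ = (β ^ 3) ^ m := by ring
      _ ≤ (‖ζ‖ ^ 7) ^ m := by gcongr
      _ = (‖ζ‖ ^ m) ^ 7 := by ring
  -- For `N = 4, 5` the power is smaller, but `θ ≥ π/3` gives `|ζ - 1| ≥ 1`; for `N ≥ 6` the bound
  -- is `(12/5 - 1) · 3/4 > 1`.
  rcases Nat.lt_or_ge N 6 with hN6 | hN6
  · have hk1 : N / 4 = 1 := by omega
    have hN5 : (N : ℝ) ≤ 5 := by exact_mod_cast (by omega : N ≤ 5)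
    have hθ3 : Real.pi / 3 ≤ θ := by
      refine le_trans ?_ hθa.le
      rw [hk1, le_div_iff₀ (by linarith)]
      push_cast
      nlinarith
    have hc : Real.cos θ ≤ 1 / 2 := by
      rw [← Real.cos_pi_div_three]
      exact Real.cos_le_cos_of_nonneg_of_le_pi (by positivity) (by linarith) hθ3
    have hD : 1 ≤ ‖ζ - 1‖ := by
      by_contra! hlt
      have := norm_nonneg (ζ - 1)
      nlinarith
    have hA2 : 2 < ‖ζ‖ ^ m := by
      refine lt_of_pow_lt_pow_left₀ 7 (by positivity) (lt_of_lt_of_le ?_ hA)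
      calc (2 : ℝ) ^ 7 < (4 / 3 * 4) ^ 3 := by norm_num
        _ ≤ (4 / 3 * N : ℝ) ^ 3 := by gcongr
    nlinarith
  · have hN6' : (6 : ℝ) ≤ N := by exact_mod_cast hN6
    have hc : Real.cos θ ≤ √2 / 2 := by
      rw [← Real.cos_pi_div_four]
      exact Real.cos_le_cos_of_nonneg_of_le_pi (by positivity) (by linarith) hθ4
    have hsqrt : √2 ≤ 1.415 := by
      rw [Real.sqrt_le_left (by norm_num)]; norm_num
    have hD : 3 / 4 ≤ ‖ζ - 1‖ := by
      by_contra! hlt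
      have := norm_nonneg (ζ - 1)
      nlinarith
    have hA2 : 12 / 5 ≤ ‖ζ‖ ^ m := by
      refine le_of_pow_le_pow_left₀ (n := 7) (by norm_num) (by positivity) (le_trans ?_ hA)
      calc (12 / 5 : ℝ) ^ 7 ≤ (4 / 3 * 6) ^ 3 := by norm_num
        _ ≤ (4 / 3 * N : ℝ) ^ 3 := by gcongr
    nlinarith

/-- Here `x^4 - x - 1 = (x² + ax + b)(x² - ax - 1/b)` over the reals. Eliminating `a` gives the
equation for `b`, and `ζ` is a root of the first factor, so `|ζ|² = b` and `|ζ - 1|² = 1 + a + b`.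
-/
theorem exists_conjugate_of_eq_four {β : ℝ} (hβ : 1 < β) (h : β ^ 4 = β + 1) :
    ∃ (ζ : ℂ) (m : ℕ), ζ ^ 4 = ζ + 1 ∧ 1 < ‖ζ‖ ∧
      (∀ g, 1 < β ^ g * (β - 1) → m ≤ g) ∧ 1 < (‖ζ‖ ^ m - 1) * ‖ζ - 1‖ := by
  have hβlt : β < 1.221 := by
    by_contra! hcon
    have h1 : (1.221 : ℝ) ^ 3 ≤ β ^ 3 := by gcongr
    nlinarith
  obtain ⟨b, ⟨hb1, hb2⟩, hb⟩ : ∃ b ∈ Set.Icc (1.13 : ℝ) 1.2,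
      (b ^ 2 - 1) * (b ^ 2 + 1) ^ 2 - b ^ 3 = 0 := by
    have hc : ContinuousOn (fun b : ℝ => (b ^ 2 - 1) * (b ^ 2 + 1) ^ 2 - b ^ 3)
        (Set.Icc 1.13 1.2) := by fun_prop
    have := intermediate_value_Icc (by norm_num : (1.13 : ℝ) ≤ 1.2) hc
    exact this ⟨by norm_num, by norm_num⟩
  set a := b / (b ^ 2 + 1) with ha
  have hb0 : 0 < b := by linarith
  have hden : 0 < b ^ 2 + 1 := by positivity
  have hmul : a * (b ^ 2 + 1) = b := div_mul_cancel₀ _ hden.ne'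
  have ha1 : 0.49 ≤ a := by rw [ha, le_div_iff₀ hden]; nlinarith
  have ha2 : a ≤ 0.5 := by rw [ha, div_le_iff₀ hden]; nlinarith [sq_nonneg (b - 1)]
  have hsq : a ^ 2 * b = b ^ 2 - 1 := by
    have h1 : (b ^ 2 + 1) ^ 2 ≠ 0 := by positivity
    apply mul_right_cancel₀ h1
    linear_combination (a * (b ^ 2 + 1) + b) * b * hmul - hb
  set r := √(b - a ^ 2 / 4) with hr
  have hr2 : r ^ 2 = b - a ^ 2 / 4 := Real.sq_sqrt (by nlinarith)
  set ζ : ℂ := ((-a / 2 : ℝ) + (r : ℝ) * Complex.I : ℂ) with hζ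
  have hquad : ζ ^ 2 + a * ζ + b = 0 := by
    have h1 : (r : ℂ) ^ 2 = b - a ^ 2 / 4 := by exact_mod_cast hr2
    rw [hζ]; push_cast
    linear_combination (r : ℂ) ^ 2 * Complex.I_sq - h1
  have hnorm : ‖ζ‖ ^ 2 = b := by
    rw [hζ, norm_sq_polar, hr2]; ring
  have hdist : ‖ζ - 1‖ ^ 2 = 1 + a + b := by
    rw [show ζ - 1 = ((-a / 2 - 1 : ℝ) + (r : ℝ) * Complex.I : ℂ) by rw [hζ]; push_cast; ring,
      norm_sq_polar, hr2]
    ring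
  -- The gap `8` is valid because `1.221^7 · 0.221 < 1`.
  refine ⟨ζ, 8, ?_, ?_, ?_, ?_⟩
  · have hbC : (b : ℂ) ≠ 0 := by exact_mod_cast hb0.ne'
    have hmulC : (a : ℂ) * (b ^ 2 + 1) = b := by exact_mod_cast hmul
    have hsqC : (a : ℂ) ^ 2 * b = b ^ 2 - 1 := by exact_mod_cast hsq
    apply mul_left_cancel₀ hbC
    linear_combination (b * ζ ^ 2 - a * b * ζ - 1) * hquad + ζ ^ 2 * hsqC + ζ * hmulC
  · by_contra! hle
    have := norm_nonneg ζ
    nlinarith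
  · intro g hg
    by_contra! hlt
    have h1 : β ^ g ≤ β ^ 7 := pow_le_pow_right₀ hβ.le (by omega)
    have h2 : β ^ 7 ≤ 1.221 ^ 7 := by gcongr
    have h3 : β ^ g * (β - 1) ≤ 1.221 ^ 7 * 0.221 := by
      exact mul_le_mul (h1.trans h2) (by linarith) (by linarith) (by norm_num)
    norm_num at h3
    linarith
  · have h8 : 1.63 ≤ ‖ζ‖ ^ 8 := by
      calc (1.63 : ℝ) ≤ 1.13 ^ 4 := by norm_num
        _ ≤ b ^ 4 := by gcongr
        _ = ‖ζ‖ ^ 8 := by rw [← hnorm]; ring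
    have hD : 1.61 ≤ ‖ζ - 1‖ := by
      by_contra! hlt
      have := norm_nonneg (ζ - 1)
      nlinarith
    nlinarith

/-! ### Conclusion -/

theorem not_isEventuallyPeriodic_of_four_le {β : ℝ} (hβ : 1 < β) (hβ2 : β ≤ 2) {n : ℕ}
    (hn : 4 ≤ n) (h : β ^ n = β + 1) : ¬ IsEventuallyPeriodic (expansionOfOne β) := by
  obtain ⟨ζ, m, hζ, hζ1, hm, hlarge⟩ : ∃ (ζ : ℂ) (m : ℕ), ζ ^ n = ζ + 1 ∧ 1 < ‖ζ‖ ∧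
      (∀ g, 1 < β ^ g * (β - 1) → m ≤ g) ∧ 1 < (‖ζ‖ ^ m - 1) * ‖ζ - 1‖ := by
    rcases hn.eq_or_lt with rfl | hn5
    · exact exists_conjugate_of_eq_four hβ h
    · obtain ⟨N, rfl⟩ : ∃ N, n = N + 1 := ⟨n - 1, by omega⟩
      exact exists_conjugate_of_five_le hβ (by omega) h
  exact not_isEventuallyPeriodic_of_conjugate hβ hβ2 (by omega) h hζ hζ1 hm hlarge

/-- The equation reads `x (x^(n-1) - 1) = 1`, whose left side is strictly increasing for `x > 1`. -/
theorem existsUnique_trinomial_root {n : ℕ} (hn : 2 ≤ n) :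
    ∃! β : ℝ, 1 < β ∧ β ^ n - β - 1 = 0 := by
  have hex : ∃ β ∈ Set.Ioo (1 : ℝ) 2, β ^ n - β - 1 = 0 := by
    have hc : ContinuousOn (fun β : ℝ => β ^ n - β - 1) (Set.Icc 1 2) := by fun_prop
    refine intermediate_value_Ioo (by norm_num) hc ⟨by norm_num, ?_⟩
    have h4 : (2 : ℝ) ^ 2 ≤ 2 ^ n := pow_le_pow_right₀ (by norm_num) hn
    linarith
  obtain ⟨β, hβ, h⟩ := hex
  have hlt : ∀ x y : ℝ, 1 < x → x < y → x ^ n - x - 1 = 0 → y ^ n - y - 1 ≠ 0 := by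
    intro x y hx hxy h1 h2
    obtain ⟨k, rfl⟩ : ∃ k, n = k + 1 := ⟨n - 1, by omega⟩
    have h3 : x ^ k < y ^ k := pow_lt_pow_left₀ hxy (by linarith) (by omega)
    have h4 : 1 < x ^ k := one_lt_pow₀ hx (by omega)
    rw [pow_succ] at h1 h2
    nlinarith
  refine ⟨β, ⟨hβ.1, h⟩, fun y ⟨hy, hy0⟩ => ?_⟩
  rcases lt_trichotomy y β with hyb | hyb | hyb
  · exact absurd h (hlt y β hy hyb hy0)
  · exact hyb
  · exact absurd hy0 (hlt β y hβ.1 hyb h)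

theorem trinomial_root_le_two {β : ℝ} (hβ : 1 < β) {n : ℕ} (hn : 2 ≤ n) (h : β ^ n = β + 1) :
    β ≤ 2 := by
  have h2 : β ^ 2 ≤ β ^ n := pow_le_pow_right₀ hβ.le hn
  nlinarith

theorem theorem1 (n : ℕ) (hn : 2 ≤ n) :
    (∃! β : ℝ, 1 < β ∧ β ^ n - β - 1 = 0) ∧
    ∀ β : ℝ, 1 < β → β ^ n - β - 1 = 0 →
      (IsParryNumber β ↔ n = 2 ∨ n = 3) ∧
      (IsEventuallyPeriodic (expansionOfOne β) ↔ n = 2 ∨ n = 3) := by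
  refine ⟨existsUnique_trinomial_root hn, fun β hβ h0 => ?_⟩
  have h : β ^ n = β + 1 := by linarith
  have hβ2 := trinomial_root_le_two hβ hn h
  have hforward : IsEventuallyPeriodic (expansionOfOne β) → n = 2 ∨ n = 3 := fun hp => by
    by_contra hcon
    exact not_isEventuallyPeriodic_of_four_le hβ hβ2 (by omega) h hp
  have hback : n = 2 ∨ n = 3 → ∃ q : ℕ, β ^ q * (β - 1) = 1 := by
    rintro (rfl | rfl)
    · exact ⟨1, by linear_combination h⟩
    -- This is `x^5 - x^4 - 1 = (x² - x + 1)(x³ - x - 1)`.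
    · exact ⟨4, by linear_combination (β ^ 2 - β + 1) * h⟩
  refine ⟨⟨fun hp => hforward (isEventuallyPeriodic_of_isParryNumber hβ hp), fun h23 => ?_⟩,
    ⟨hforward, fun h23 => ?_⟩⟩
  · obtain ⟨q, hq⟩ := hback h23
    exact isParryNumber_of_ite_dvd hβ hβ2 (expansionOfOne_eq_ite_dvd hβ hβ2 hq)
  · obtain ⟨q, hq⟩ := hback h23
    exact isEventuallyPeriodic_of_ite_dvd (expansionOfOne_eq_ite_dvd hβ hβ2 hq)
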